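/- For integers $n, d \ge 0$, a $d$-dimensional subcube of $\{0,1\}^n$ is a subset of the form $\{x \in \{0,1\}^n : x_i = c_i \text{ for all } i \in F\}$, where $F \subseteq \{1,\dots,n\}$ has exactly $n-d$ elements and $c_i \in \{0,1\}$ for each $i \in F$ (so there are none if $d > n$). Let $g(n,d)$ be the minimal size of a subset of $\{0,1\}^n$ that intersects every $d$-dimensional subcube of $\{0,1\}^n$. For every $d$ the limit $\gamma_d = \lim_{n \to \infty} g(n,d)/2^n$ exists, and the following hold. (i) There is an absolute constant $c$ with $0 < c < 1$ such that $\gamma_d \le c^d$ for all integers $d \ge 0$. (ii) $\gamma_d < \frac{1}{d+1}$ for all integers $d \ge 8$. -/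

import Mathlib

open Filter Topology

/-- `S` is (the vertex set of) a `d`-dimensional subcube of `{0,1}^n`: for some set `F` of `n - d`
coordinates and some prescribed values `c`, it consists of all points agreeing with `c` on `F`.
(The values of `c` outside `F` play no role; for `d > n` there is no such set.) -/
def IsSubcube (n d : ℕ) (S : Set (Fin n → Bool)) : Prop :=
  ∃ (F : Finset (Fin n)) (c : Fin n → Bool),
    F.card + d = n ∧ S = {x : Fin n → Bool | ∀ i ∈ F, x i = c i}

/-- `A` intersects the vertex set of every `d`-dimensional subcube of `{0,1}^n`. -/
def MeetsAllSubcubes (n d : ℕ) (A : Finset (Fin n → Bool)) : Prop :=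
  ∀ S : Set (Fin n → Bool), IsSubcube n d S → ((A : Set (Fin n → Bool)) ∩ S).Nonempty

/-- The minimal size `g(n, d)` of a subset of `{0,1}^n` that intersects the vertex set of every
`d`-dimensional subcube. -/
noncomputable def minTransversal (n d : ℕ) : ℕ :=
  sInf {m : ℕ | ∃ A : Finset (Fin n → Bool), MeetsAllSubcubes n d A ∧ A.card = m}

/-- The density `γ_d = lim_{n → ∞} g(n, d) / 2^n`. -/
noncomputable def cubeGamma (d : ℕ) : ℝ :=
  limUnder atTop (fun n : ℕ => (minTransversal n d : ℝ) / (2 : ℝ) ^ n)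

/-! The densities increase with `n`, since a transversal splits over two opposite facets, and they
are at most 1; so the limit exists.

For the upper bounds, let `q = |K|` and attach to each coordinate, separately for each weight `w`, a
vector of `K ^ (w - k)`. Select the points of weight `w` whose `w` vectors fail to span. A
first-moment count (`exists_card_nonSpanning_le`) gives labels for which at most a fraction `1 / ((q
- 1) q ^ k)` of the layer is selected. Keeping only the weights in the best residue class modulo `L`
gains a further factor `L`.

Take a subcube whose fixed ones form `S`. The functionals killing the vectors of `S` form a space of
dimension at least `b - k`, where `w = |S| + b`. If some nonzero one among them kills `b` of the `d`
free vectors, those `b` coordinates together with `S` give a selected point of the subcube. This is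
`ForcesCommonZeros`, needed for `L` consecutive values of `b`.

Over the field of two elements, with `b = k + 2` and `L = 1`, pigeonhole on the three nonzero
vectors of a plane gives exponential decay. Over the field of three elements, with `k = 0` and `2 ≤
b ≤ d - 2`, the bound is `1 / (2 (d - 3))`. -/

/-! ### Existence of the limit density. -/

theorem minTransversal_le {n d : ℕ} {A : Finset (Fin n → Bool)} (hA : MeetsAllSubcubes n d A) :
    minTransversal n d ≤ A.card :=
  Nat.sInf_le ⟨A, hA, rfl⟩

theorem meetsAllSubcubes_univ (n d : ℕ) : MeetsAllSubcubes n d Finset.univ := by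
  rintro S ⟨F, c, -, rfl⟩
  exact ⟨c, by simp⟩

theorem exists_card_eq_minTransversal (n d : ℕ) :
    ∃ A : Finset (Fin n → Bool), MeetsAllSubcubes n d A ∧ A.card = minTransversal n d :=
  Nat.sInf_mem (s := {m : ℕ | ∃ A : Finset (Fin n → Bool), MeetsAllSubcubes n d A ∧ A.card = m})
    ⟨_, Finset.univ, meetsAllSubcubes_univ n d, rfl⟩

theorem minTransversal_le_two_pow (n d : ℕ) : minTransversal n d ≤ 2 ^ n := by
  simpa using minTransversal_le (meetsAllSubcubes_univ n d)

/-- Each facet of the cube inherits a transversal. -/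
theorem MeetsAllSubcubes.facet {n d : ℕ} {A : Finset (Fin (n + 1) → Bool)}
    (hA : MeetsAllSubcubes (n + 1) d A) (b : Bool) :
    MeetsAllSubcubes n d (Finset.univ.filter fun x => Fin.cons b x ∈ A) := by
  rintro S ⟨F, c, hF, rfl⟩
  obtain ⟨y, hyA, hy⟩ := hA {x | ∀ i ∈ insert 0 (F.map (Fin.succEmb n)), x i = (Fin.cons b c : Fin (n + 1) → Bool) i}
    ⟨insert 0 (F.map (Fin.succEmb n)), Fin.cons b c, by
      rw [Finset.card_insert_of_notMem (by simp [Fin.succ_ne_zero]), Finset.card_map]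
      omega, rfl⟩
  have h0 : y 0 = b := by simpa using hy 0 (by simp)
  refine ⟨Fin.tail y, ?_, fun i hi => ?_⟩
  · rw [← h0]
    simpa using hyA
  · simpa [Fin.tail] using hy i.succ (by simp [hi])

theorem two_mul_minTransversal_le (n d : ℕ) :
    2 * minTransversal n d ≤ minTransversal (n + 1) d := by
  obtain ⟨A, hA, hcard⟩ := exists_card_eq_minTransversal (n + 1) d
  have h (b : Bool) : (Finset.univ.filter fun x : Fin n → Bool => Fin.cons b x ∈ A).card
      = (A.filter fun y => y 0 = b).card := by
    refine Finset.card_bij (fun x _ => Fin.cons b x) (by simp) (fun x _ y _ hxy => ?_)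
      (fun y hy => ⟨Fin.tail y, ?_, ?_⟩)
    · exact (Fin.cons_injective2 hxy).2
    · rw [Finset.mem_filter] at hy
      simp [← hy.2, hy.1]
    · rw [Finset.mem_filter] at hy
      simp [← hy.2]
  have h1 := minTransversal_le (hA.facet true)
  have h2 := minTransversal_le (hA.facet false)
  rw [h] at h1 h2
  have h3 := Finset.card_filter_add_card_filter_not (s := A) (fun y => y 0 = true)
  simp only [Bool.not_eq_true] at h3
  omega

theorem monotone_minTransversal_div (d : ℕ) :
    Monotone fun n : ℕ => (minTransversal n d : ℝ) / (2 : ℝ) ^ n := by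
  refine monotone_nat_of_le_succ fun n => ?_
  rw [div_le_div_iff₀ (by positivity) (by positivity), pow_succ]
  have : (2 : ℝ) * minTransversal n d ≤ minTransversal (n + 1) d :=
    mod_cast two_mul_minTransversal_le n d
  nlinarith [pow_pos (two_pos : (0 : ℝ) < 2) n]

theorem tendsto_cubeGamma (d : ℕ) :
    Tendsto (fun n : ℕ => (minTransversal n d : ℝ) / (2 : ℝ) ^ n) atTop (𝓝 (cubeGamma d)) := by
  refine tendsto_nhds_limUnder ⟨_, tendsto_atTop_ciSup (monotone_minTransversal_div d) ⟨1, ?_⟩⟩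
  rintro _ ⟨n, rfl⟩
  exact div_le_one_of_le₀ (mod_cast minTransversal_le_two_pow n d) (by positivity)

theorem cubeGamma_le_of_mul_le {d N : ℕ} (hN : 0 < N)
    (h : ∀ n, N * minTransversal n d ≤ 2 ^ n) : cubeGamma d ≤ 1 / N := by
  refine le_of_tendsto' (tendsto_cubeGamma d) fun n => ?_
  rw [div_le_div_iff₀ (by positivity) (by positivity), one_mul, mul_comm]
  exact_mod_cast h n

/-! ### Random labels: few sets are non-spanning. -/

/-- The points of weight `w` of the discrete cube. -/
def cubeLayer (n w : ℕ) : Finset (Fin n → Bool) :=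
  Finset.univ.filter fun x => (Finset.univ.filter fun i => x i = true).card = w

open Classical in
/-- The sets of size `w` (as indicator vectors) along which `v` does not span `K ^ m`. -/
noncomputable def nonSpanning {K : Type} [Field K] {n m : ℕ} (v : Fin n → Fin m → K) (w : ℕ) :
    Finset (Fin n → Bool) :=
  (cubeLayer n w).filter fun x => ∃ f : Fin m → K, f ≠ 0 ∧ ∀ i, x i = true → f ⬝ᵥ v i = 0

theorem mem_nonSpanning {K : Type} [Field K] {n m w : ℕ} {v : Fin n → Fin m → K}
    {x : Fin n → Bool} : x ∈ nonSpanning v w ↔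
      x ∈ cubeLayer n w ∧ ∃ f : Fin m → K, f ≠ 0 ∧ ∀ i, x i = true → f ⬝ᵥ v i = 0 := by
  classical
  exact Finset.mem_filter

theorem card_dotProduct_eq_zero {K : Type} [Field K] [Fintype K] [DecidableEq K] {m : ℕ}
    {f : Fin m → K} (hf : f ≠ 0) :
    (Finset.univ.filter fun u : Fin m → K => f ⬝ᵥ u = 0).card * Fintype.card K
      = Fintype.card K ^ m := by
  classical
  obtain ⟨j, hj⟩ := Function.ne_iff.1 hf
  -- All level sets of `f` are translates of its kernel along a coordinate where `f` is nonzero.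
  have key (c : K) : (Finset.univ.filter fun u : Fin m → K => f ⬝ᵥ u = 0).card
      = (Finset.univ.filter fun u : Fin m → K => f ⬝ᵥ u = c).card := by
    refine Finset.card_equiv (Equiv.addRight (Pi.single j (c / f j))) fun u => ?_
    have hj' : f j ≠ 0 := hj
    simp [dotProduct_add, mul_div_cancel₀ _ hj']
  have h := Finset.card_eq_sum_card_fiberwise (s := (Finset.univ : Finset (Fin m → K)))
    (t := (Finset.univ : Finset K)) (f := fun u => f ⬝ᵥ u) (by simp [Set.MapsTo])
  rw [Finset.sum_congr rfl fun c _ => (key c).symm] at h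
  simpa [mul_comm] using h.symm

/-- The labels are independent, and each of the `w` relevant ones lies in the hyperplane `f = 0`
with probability `1 / q`. -/
theorem card_annihilated {K : Type} [Field K] [Fintype K] [DecidableEq K] {n m w : ℕ}
    {f : Fin m → K} (hf : f ≠ 0) {x : Fin n → Bool} (hx : x ∈ cubeLayer n w) :
    (Finset.univ.filter fun v : Fin n → Fin m → K => ∀ i, x i = true → f ⬝ᵥ v i = 0).card
      * Fintype.card K ^ w = Fintype.card (Fin n → Fin m → K) := by
  have h1 : (Finset.univ.filter fun v : Fin n → Fin m → K => ∀ i, x i = true → f ⬝ᵥ v i = 0)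
      = Fintype.piFinset fun i =>
        Finset.univ.filter fun u : Fin m → K => x i = true → f ⬝ᵥ u = 0 := by
    ext v
    simp
  have h2 : Fintype.card K ^ w = ∏ i, if x i = true then Fintype.card K else 1 := by
    rw [← (Finset.mem_filter.1 hx).2, Finset.prod_ite]
    simp
  rw [h1, h2, Fintype.card_piFinset, ← Finset.prod_mul_distrib, Fintype.card_pi]
  refine Finset.prod_congr rfl fun i _ => ?_
  by_cases hi : x i = true
  · simpa [hi] using card_dotProduct_eq_zero hf
  · simp [hi]

/-- An annihilating functional comes with its `q - 1` nonzero multiples. This factor is what makes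
three elements better than two when `k = 0`. -/
theorem card_nonSpanning_le_sum {K : Type} [Field K] [Fintype K] [DecidableEq K] {n m : ℕ}
    (v : Fin n → Fin m → K) (w : ℕ) :
    (Fintype.card K - 1) * (nonSpanning v w).card ≤ ∑ x ∈ cubeLayer n w,
      (Finset.univ.filter fun f : Fin m → K =>
        f ≠ 0 ∧ ∀ i, x i = true → f ⬝ᵥ v i = 0).card := by
  classical
  rw [nonSpanning, mul_comm, ← smul_eq_mul, ← Finset.sum_const, Finset.sum_filter]
  refine Finset.sum_le_sum fun x _ => ?_
  split_ifs with h
  · obtain ⟨f, hf, hv⟩ := h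
    rw [← Fintype.card_units]
    refine Finset.card_le_card_of_injOn (fun u : Kˣ => u • f) (fun u _ => ?_)
      (fun a _ b _ hab => ?_)
    · simp only [Finset.coe_filter, Finset.mem_univ, true_and, Set.mem_ofPred_eq]
      refine ⟨(Units.smul_def u f).symm ▸ smul_ne_zero u.ne_zero hf, fun i hi => ?_⟩
      rw [Units.smul_def, smul_dotProduct, hv i hi, smul_zero]
    · exact Units.ext (smul_left_injective K hf (by simpa [Units.smul_def] using hab))
  · simp

theorem exists_card_nonSpanning_le (K : Type) [Field K] [Fintype K] (n m k : ℕ) :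
    ∃ v : Fin n → Fin m → K, (Fintype.card K - 1) * Fintype.card K ^ k
      * (nonSpanning v (m + k)).card ≤ (cubeLayer n (m + k)).card := by
  classical
  obtain ⟨q, hqK⟩ : ∃ q, q = Fintype.card K := ⟨_, rfl⟩
  have hq : 0 < q := hqK ▸ Fintype.card_pos
  rw [← hqK]
  have hcount (x : Fin n → Bool) : ∑ v : Fin n → Fin m → K, (Finset.univ.filter
      fun f : Fin m → K => f ≠ 0 ∧ ∀ i, x i = true → f ⬝ᵥ v i = 0).card
      = ∑ f ∈ Finset.univ.filter fun f : Fin m → K => f ≠ 0, (Finset.univ.filter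
        fun v : Fin n → Fin m → K => ∀ i, x i = true → f ⬝ᵥ v i = 0).card := by
    simp only [← Finset.filter_filter]
    exact Finset.sum_card_bipartiteAbove_eq_sum_card_bipartiteBelow
      (fun (v : Fin n → Fin m → K) (f : Fin m → K) => ∀ i, x i = true → f ⬝ᵥ v i = 0)
  -- First moment over all labellings: fewer than `q ^ m` nonzero functionals, each annihilating a
  -- given set with probability `q ^ (-(m + k))`.
  have hsum : ∑ v : Fin n → Fin m → K, q ^ (m + k) * ((q - 1) * (nonSpanning v (m + k)).card)
      ≤ ∑ _v : Fin n → Fin m → K, q ^ m * (cubeLayer n (m + k)).card := by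
    calc _ ≤ ∑ v : Fin n → Fin m → K, q ^ (m + k) * ∑ x ∈ cubeLayer n (m + k),
          (Finset.univ.filter fun f : Fin m → K =>
            f ≠ 0 ∧ ∀ i, x i = true → f ⬝ᵥ v i = 0).card :=
          Finset.sum_le_sum fun v _ => 
            Nat.mul_le_mul_left _ (by rw [hqK]; exact card_nonSpanning_le_sum v _)
      _ = ∑ x ∈ cubeLayer n (m + k), ∑ f ∈ Finset.univ.filter fun f : Fin m → K => f ≠ 0,
          (Finset.univ.filter fun v : Fin n → Fin m → K =>
            ∀ i, x i = true → f ⬝ᵥ v i = 0).card * q ^ (m + k) := by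
          simp_rw [← Finset.sum_mul, ← Finset.mul_sum]
          rw [mul_comm, Finset.sum_comm]
          congr 1
          exact Finset.sum_congr rfl fun x _ => (hcount x)
      _ = ∑ x ∈ cubeLayer n (m + k), ∑ f ∈ Finset.univ.filter fun f : Fin m → K => f ≠ 0,
          Fintype.card (Fin n → Fin m → K) := by
          refine Finset.sum_congr rfl fun x hx => Finset.sum_congr rfl fun f hf => ?_
          rw [hqK]
          exact card_annihilated (Finset.mem_filter.1 hf).2 hx
      _ ≤ ∑ x ∈ cubeLayer n (m + k), q ^ m * Fintype.card (Fin n → Fin m → K) := by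
          refine Finset.sum_le_sum fun x _ => ?_
          rw [Finset.sum_const, smul_eq_mul]
          refine Nat.mul_le_mul_right _ ((Finset.card_filter_le _ _).trans ?_)
          simp [hqK]
      _ = _ := by
          simp only [Finset.sum_const, smul_eq_mul, Finset.card_univ]
          ring
  obtain ⟨v, -, hv⟩ := Finset.exists_le_of_sum_le (Finset.univ_nonempty) hsum
  refine ⟨v, Nat.le_of_mul_le_mul_left ?_ (pow_pos hq m)⟩
  calc _ = _ := by ring
    _ ≤ _ := hv

/-! ### Common zeros of many functionals. -/

/-- Any `d` linear functionals on a `K`-space of dimension at least `a` have `b` members that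
vanish at a common nonzero vector. -/
def ForcesCommonZeros (K : Type) [Field K] (d a b : ℕ) : Prop :=
  ∀ (V : Type) [AddCommGroup V] [Module K V] [FiniteDimensional K V] (ι : Type) (T : Finset ι)
    (φ : ι → V →ₗ[K] K), a ≤ Module.finrank K V → T.card = d →
      ∃ f : V, f ≠ 0 ∧ ∃ T' ⊆ T, T'.card = b ∧ ∀ t ∈ T', φ t f = 0

/-- The common zeros of a finite family of functionals. -/
def commonZeros {K V ι : Type} [Field K] [AddCommGroup V] [Module K V] (T : Finset ι)
    (φ : ι → V →ₗ[K] K) : Submodule K V :=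
  LinearMap.ker (LinearMap.pi fun t : T => φ t)

theorem mem_commonZeros {K V ι : Type} [Field K] [AddCommGroup V] [Module K V] {T : Finset ι}
    {φ : ι → V →ₗ[K] K} {f : V} : f ∈ commonZeros T φ ↔ ∀ t ∈ T, φ t f = 0 := by
  simp [commonZeros, funext_iff]

theorem finrank_le_finrank_commonZeros {K V ι : Type} [Field K] [AddCommGroup V] [Module K V]
    [FiniteDimensional K V] (T : Finset ι) (φ : ι → V →ₗ[K] K) :
    Module.finrank K V ≤ Module.finrank K (commonZeros T φ) + T.card := by
  have h := (LinearMap.pi fun t : T => φ t).finrank_range_add_finrank_ker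
  have h' := Submodule.finrank_le (LinearMap.range (LinearMap.pi fun t : T => φ t))
  simp only [Module.finrank_fintype_fun_eq_card, Fintype.card_coe] at h'
  rw [commonZeros]
  linarith

/-- Some functionals may be required to vanish from the start. -/
theorem ForcesCommonZeros.add {K : Type} [Field K] {d a b : ℕ} (h : ForcesCommonZeros K d a b)
    (r : ℕ) : ForcesCommonZeros K (d + r) (a + r) (b + r) := by
  classical
  intro V _ _ _ ι T φ hV hT
  obtain ⟨T₀, hT₀, hr⟩ := Finset.exists_subset_card_eq (s := T) (n := r) (by omega)
  have hfin := finrank_le_finrank_commonZeros T₀ φ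
  obtain ⟨f, hf, T', hT', hb, hz⟩ := h (commonZeros T₀ φ) ι (T \ T₀)
    (fun t => (φ t).comp (commonZeros T₀ φ).subtype) (by omega)
    (by rw [Finset.card_sdiff_of_subset hT₀]; omega)
  refine ⟨f, by simpa using hf, T' ∪ T₀,
    Finset.union_subset (hT'.trans Finset.sdiff_subset) hT₀, ?_, fun t ht => ?_⟩
  · rw [Finset.card_union_of_disjoint, hb, hr]
    exact Finset.disjoint_of_subset_left hT' Finset.sdiff_disjoint
  · rcases Finset.mem_union.1 ht with h | h
    · exact hz t h
    · exact mem_commonZeros.1 f.2 t h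

theorem ForcesCommonZeros.mono {K : Type} [Field K] {d d' a b : ℕ}
    (h : ForcesCommonZeros K d a b) (hd : d ≤ d') : ForcesCommonZeros K d' a b := by
  intro V _ _ _ ι T φ hV hT
  obtain ⟨T₀, hT₀, hr⟩ := Finset.exists_subset_card_eq (s := T) (n := d) (by omega)
  obtain ⟨f, hf, T', hT', hb, hz⟩ := h V ι T₀ φ hV hr
  exact ⟨f, hf, T', hT'.trans hT₀, hb, hz⟩

/-- Pigeonhole: if each functional vanishes on one of finitely many nonzero vectors, then some
vector is a zero of many functionals. -/
theorem exists_common_zero_of_pigeonhole {K V ι : Type} [Field K] [AddCommGroup V] [Module K V]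
    {p b : ℕ} (g : Fin p → V) (hg : ∀ j, g j ≠ 0) (T : Finset ι) (φ : ι → V →ₗ[K] K)
    (hz : ∀ t ∈ T, ∃ j, φ t (g j) = 0) (hT : p * b < T.card + p) :
    ∃ f : V, f ≠ 0 ∧ ∃ T' ⊆ T, T'.card = b ∧ ∀ t ∈ T', φ t f = 0 := by
  classical
  obtain rfl | hp := p.eq_zero_or_pos
  · obtain ⟨t, ht⟩ := Finset.card_pos.1 (by omega : 0 < T.card)
    exact (hz t ht).choose.elim0
  have : Nonempty (Fin p) := ⟨⟨0, hp⟩⟩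
  choose! j hj using hz
  suffices ∃ i, b ≤ (T.filter fun t => j t = i).card by
    obtain ⟨i, hi⟩ := this
    obtain ⟨T', hT', hb⟩ := Finset.exists_subset_card_eq hi
    refine ⟨g i, hg i, T', hT'.trans (Finset.filter_subset _ _), hb, fun t ht => ?_⟩
    obtain ⟨h1, h2⟩ := Finset.mem_filter.1 (hT' ht)
    rw [← h2]
    exact hj t h1
  by_contra! hlt
  have h := Finset.card_eq_sum_card_fiberwise (s := T) (t := (Finset.univ : Finset (Fin p)))
    (f := j) (by simp [Set.MapsTo])
  have h' : ∑ i : Fin p, ((T.filter fun t => j t = i).card + 1) ≤ ∑ _i : Fin p, b :=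
    Finset.sum_le_sum fun i _ => hlt i
  rw [Finset.sum_add_distrib, ← h] at h'
  simp at h'
  omega

/-- It suffices to consider functionals on `K ^ a`. -/
theorem ForcesCommonZeros.of_fun {K : Type} [Field K] {d a b : ℕ}
    (h : ∀ (ι : Type) (T : Finset ι) (φ : ι → (Fin a → K) →ₗ[K] K), T.card = d →
      ∃ f : Fin a → K, f ≠ 0 ∧ ∃ T' ⊆ T, T'.card = b ∧ ∀ t ∈ T', φ t f = 0) :
    ForcesCommonZeros K d a b := by
  intro V _ _ _ ι T φ hV hT
  have he := (Module.finBasis K V).linearIndependent.comp _ (Fin.castLE_injective hV)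
  set e := Module.finBasis K V ∘ Fin.castLE hV
  obtain ⟨f, hf, T', hT', hb, hz⟩ := h ι T (fun t => (φ t).comp (Fintype.linearCombination K e)) hT
  refine ⟨Fintype.linearCombination K e f, fun h0 => hf ?_, T', hT', hb, hz⟩
  exact he.fintypeLinearCombination_injective (by rw [h0, map_zero])

theorem forcesCommonZeros_zmod_two {d b : ℕ} (h : 3 * b < d + 3) :
    ForcesCommonZeros (ZMod 2) d 2 b := by
  refine .of_fun fun ι T φ hT => ?_
  -- One vector on each line of the plane; every functional vanishes on at least one line.
  refine exists_common_zero_of_pigeonhole ![![1, 0], ![0, 1], ![1, 0] + ![0, 1]] (by decide) T φ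
    (fun t _ => ?_) (by omega)
  have key : ∀ x y : ZMod 2, x = 0 ∨ y = 0 ∨ x + y = 0 := by decide
  rcases key (φ t ![1, 0]) (φ t ![0, 1]) with h | h | h
  exacts [⟨0, h⟩, ⟨1, h⟩, ⟨2, (map_add (φ t) _ _).trans h⟩]

theorem forcesCommonZeros_zmod_three_two : ForcesCommonZeros (ZMod 3) 5 2 2 := by
  refine .of_fun fun ι T φ hT => ?_
  refine exists_common_zero_of_pigeonhole
    ![![1, 0], ![0, 1], ![1, 0] + ![0, 1], ![1, 0] - ![0, 1]] (by decide) T φ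
    (fun t _ => ?_) (by omega)
  have key : ∀ x y : ZMod 3, x = 0 ∨ y = 0 ∨ x + y = 0 ∨ x - y = 0 := by decide
  rcases key (φ t ![1, 0]) (φ t ![0, 1]) with h | h | h | h
  exacts [⟨0, h⟩, ⟨1, h⟩, ⟨2, (map_add (φ t) _ _).trans h⟩, ⟨3, (map_sub (φ t) _ _).trans h⟩]

/-- The projective plane over the field with three elements contains no arc of size five. -/
theorem forcesCommonZeros_zmod_three_three : ForcesCommonZeros (ZMod 3) 5 3 3 := by
  classical
  refine .of_fun fun ι T φ hT => ?_
  let s : Fin 5 ↪ ι := (T.equivFinOfCardEq hT).symm.toEmbedding.trans (Function.Embedding.subtype _)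
  have of_zeros (f : Fin 3 → ZMod 3) (hf : f ≠ 0) (J : Finset (Fin 5)) (hJ : J.card = 3)
      (hz : ∀ j ∈ J, φ (s j) f = 0) :
      ∃ f : Fin 3 → ZMod 3, f ≠ 0 ∧ ∃ T' ⊆ T, T'.card = 3 ∧ ∀ t ∈ T', φ t f = 0 := by
    refine ⟨f, hf, J.map s, fun t ht => ?_, by simpa using hJ, fun t ht => ?_⟩
    · obtain ⟨j, -, rfl⟩ := Finset.mem_map.1 ht
      simp [s]
    · obtain ⟨j, hj, rfl⟩ := Finset.mem_map.1 ht
      exact hz j hj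
  let Φ : (Fin 3 → ZMod 3) →ₗ[ZMod 3] Fin 3 → ZMod 3 :=
    LinearMap.pi fun i => φ (s (Fin.castLE (by norm_num) i))
  -- If the first three functionals are independent they serve as coordinates; otherwise they
  -- already share a nonzero zero.
  by_cases hΦ : Function.Injective Φ
  · have hsurj : Function.Surjective Φ := LinearMap.injective_iff_surjective.1 hΦ
    let L : (Fin 3 → ZMod 3) ≃ₗ[ZMod 3] Fin 3 → ZMod 3 := LinearEquiv.ofBijective Φ ⟨hΦ, hsurj⟩
    have hL (u : Fin 3 → ZMod 3) (i : Fin 3) : φ (s (Fin.castLE (by norm_num) i)) (L.symm u) = u i :=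
      congrFun (L.apply_symm_apply u) i
    have h0 (u) : φ (s 0) (L.symm u) = u 0 := hL u 0
    have h1 (u) : φ (s 1) (L.symm u) = u 1 := hL u 1
    have h2 (u) : φ (s 2) (L.symm u) = u 2 := hL u 2
    have hlin (j : Fin 5) (u : Fin 3 → ZMod 3) : φ (s j) (L.symm u)
        = u 0 * φ (s j) (L.symm (Pi.single 0 1)) + u 1 * φ (s j) (L.symm (Pi.single 1 1))
          + u 2 * φ (s j) (L.symm (Pi.single 2 1)) := by
      have : u = u 0 • Pi.single 0 1 + u 1 • Pi.single 1 1 + u 2 • Pi.single 2 1 := by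
        ext i
        fin_cases i <;> simp
      conv_lhs => rw [this]
      simp only [map_add, map_smul, smul_eq_mul]
    have h3 := hlin 3
    have h4 := hlin 4
    generalize φ (s 3) (L.symm (Pi.single 0 1)) = a at h3
    generalize φ (s 3) (L.symm (Pi.single 1 1)) = b at h3
    generalize φ (s 3) (L.symm (Pi.single 2 1)) = c at h3
    generalize φ (s 4) (L.symm (Pi.single 0 1)) = x at h4
    generalize φ (s 4) (L.symm (Pi.single 1 1)) = y at h4
    generalize φ (s 4) (L.symm (Pi.single 2 1)) = z at h4
    -- If all six coefficients are nonzero, the ratios `x / a`, `y / b`, `z / c` lie in `{1, -1}`,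
    -- so two agree and a 2 × 2 minor vanishes. The conjunct `≠ 0` keeps the resulting witness
    -- nonzero.
    have key : ∀ a b c x y z : ZMod 3, a = 0 ∨ b = 0 ∨ c = 0 ∨ x = 0 ∨ y = 0 ∨ z = 0 ∨
        (a ≠ 0 ∧ a * y = b * x) ∨ (a ≠ 0 ∧ a * z = c * x) ∨ (b ≠ 0 ∧ b * z = c * y) := by decide
    have of_coords (u : Fin 3 → ZMod 3) (hu : u ≠ 0) (J : Finset (Fin 5)) (hJ : J.card = 3)
        (hz : ∀ j ∈ J, φ (s j) (L.symm u) = 0) :=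
      of_zeros (L.symm u) (by simpa using hu) J hJ hz
    rcases key a b c x y z with h | h | h | h | h | h | ⟨h, h'⟩ | ⟨h, h'⟩ | ⟨h, h'⟩
    · exact of_coords ![1, 0, 0] (by decide) {1, 2, 3} rfl (by simp [h1, h2, h3, h])
    · exact of_coords ![0, 1, 0] (by decide) {0, 2, 3} rfl (by simp [h0, h2, h3, h])
    · exact of_coords ![0, 0, 1] (by decide) {0, 1, 3} rfl (by simp [h0, h1, h3, h])
    · exact of_coords ![1, 0, 0] (by decide) {1, 2, 4} rfl (by simp [h1, h2, h4, h])
    · exact of_coords ![0, 1, 0] (by decide) {0, 2, 4} rfl (by simp [h0, h2, h4, h])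
    · exact of_coords ![0, 0, 1] (by decide) {0, 1, 4} rfl (by simp [h0, h1, h4, h])
    · exact of_coords ![b, -a, 0] (by simp [h]) {2, 3, 4} rfl
        (by simp [h2, h3, h4, h', mul_comm b a])
    · exact of_coords ![c, 0, -a] (by simp [h]) {1, 3, 4} rfl
        (by simp [h1, h3, h4, h', mul_comm c a])
    · exact of_coords ![0, c, -b] (by simp [h]) {0, 3, 4} rfl
        (by simp [h0, h3, h4, h', mul_comm c b])
  · rw [← LinearMap.ker_eq_bot, ← ne_eq, Submodule.ne_bot_iff] at hΦ
    obtain ⟨f, hf, hne⟩ := hΦ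
    refine of_zeros f hne {0, 1, 2} rfl ?_
    have h (i : Fin 3) : φ (s (Fin.castLE (by norm_num) i)) f = 0 := congrFun hf i
    simpa using ⟨h 0, h 1, h 2⟩

theorem forcesCommonZeros_zmod_three {d b : ℕ} (hd : 5 ≤ d) (hb : 2 ≤ b) (hbd : b + 2 ≤ d) :
    ForcesCommonZeros (ZMod 3) d b b := by
  obtain rfl | hb := hb.eq_or_lt
  · exact forcesCommonZeros_zmod_three_two.mono hd
  · obtain ⟨r, rfl⟩ := Nat.exists_eq_add_of_lt hb
    rw [show 2 + r + 1 = 3 + r by ring]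
    exact (forcesCommonZeros_zmod_three_three.add r).mono (by omega)

/-! ### The transversal and its density. -/

open Classical in
/-- The layers of weight congruent to `c` modulo `L` of non-spanning sets, where in the layer of
weight `w` the points are labelled by vectors `v w i` of length `w - k`. -/
noncomputable def spanTransversal {K : Type} [Field K] {n k : ℕ}
    (v : (w : ℕ) → Fin n → Fin (w - k) → K) (L c : ℕ) : Finset (Fin n → Bool) :=
  (Finset.range (n + 1)).biUnion fun w => if w % L = c then nonSpanning (v w) w else ∅

/-- Extends the estimate to the layers with `w ≤ k`, where truncated subtraction makes the label
space zero and no point is selected. -/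
theorem exists_card_nonSpanning_sub_le (K : Type) [Field K] [Fintype K] (n k w : ℕ) :
    ∃ v : Fin n → Fin (w - k) → K, (Fintype.card K - 1) * Fintype.card K ^ k
      * (nonSpanning v w).card ≤ (cubeLayer n w).card := by
  obtain h | h := le_total k w
  · simpa [Nat.sub_add_cancel h] using exists_card_nonSpanning_le K n (w - k) k
  · have : IsEmpty (Fin (w - k)) := by
      rw [Nat.sub_eq_zero_of_le h]
      infer_instance
    have hempty (v : Fin n → Fin (w - k) → K) : nonSpanning v w = ∅ := by
      refine Finset.eq_empty_of_forall_notMem fun x hx => ?_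
      obtain ⟨-, f, hf, -⟩ := mem_nonSpanning.1 hx
      exact hf (Subsingleton.elim _ _)
    exact ⟨fun _ _ => 0, by simp [hempty]⟩

theorem sum_card_cubeLayer (n : ℕ) :
    ∑ w ∈ Finset.range (n + 1), (cubeLayer n w).card = 2 ^ n := by
  have h := Finset.card_eq_sum_card_fiberwise (s := (Finset.univ : Finset (Fin n → Bool)))
    (t := Finset.range (n + 1)) (f := fun x => (Finset.univ.filter fun i => x i = true).card)
    (fun x _ => by
      have := Finset.card_le_univ (Finset.univ.filter fun i => x i = true)
      simp only [Fintype.card_fin] at this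
      simpa using Nat.lt_succ_of_le this)
  simpa [cubeLayer] using h.symm

theorem sum_card_spanTransversal_le {K : Type} [Field K] {n k L : ℕ} (hL : 0 < L)
    (v : (w : ℕ) → Fin n → Fin (w - k) → K) :
    ∑ c ∈ Finset.range L, (spanTransversal v L c).card
      ≤ ∑ w ∈ Finset.range (n + 1), (nonSpanning (v w) w).card := by
  calc _ ≤ ∑ c ∈ Finset.range L, ∑ w ∈ Finset.range (n + 1),
        if w % L = c then (nonSpanning (v w) w).card else 0 := by
        refine Finset.sum_le_sum fun c _ => Finset.card_biUnion_le.trans_eq ?_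
        refine Finset.sum_congr rfl fun w _ => ?_
        split_ifs <;> simp
    _ = _ := by
        rw [Finset.sum_comm]
        refine Finset.sum_congr rfl fun w _ => ?_
        simp [Nat.mod_lt _ hL]

theorem exists_mod_eq (s b₀ c : ℕ) {L : ℕ} (hc : c < L) :
    ∃ b, b₀ ≤ b ∧ b < b₀ + L ∧ (s + b) % L = c := by
  have hL : 0 < L := by omega
  refine ⟨b₀ + (c + (L - (s + b₀) % L)) % L, by omega,
    by have := Nat.mod_lt (c + (L - (s + b₀) % L)) hL; omega, ?_⟩
  have h1 := Nat.mod_lt (s + b₀) hL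
  rw [← add_assoc, Nat.add_mod, Nat.mod_mod, ← Nat.add_mod_mod, Nat.mod_mod,
    Nat.add_mod_mod, show (s + b₀) % L + (c + (L - (s + b₀) % L)) = c + L by omega,
    Nat.add_mod_right, Nat.mod_eq_of_lt hc]

theorem meetsAllSubcubes_spanTransversal {K : Type} [Field K] {n d k b₀ L c : ℕ} (hc : c < L)
    (h : ∀ b, b₀ ≤ b → b < b₀ + L → ForcesCommonZeros K d (b - k) b)
    (v : (w : ℕ) → Fin n → Fin (w - k) → K) :
    MeetsAllSubcubes n d (spanTransversal v L c) := by
  classical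
  rintro _ ⟨F, y, hF, rfl⟩
  set S : Finset (Fin n) := F.filter fun i => y i = true
  -- `b` is the number of free coordinates to be set to one; a window of `L` values reaches every
  -- residue class.
  obtain ⟨b, hb, hbL, hmod⟩ := exists_mod_eq S.card b₀ c hc
  set w := S.card + b
  let φ (i : Fin n) : (Fin (w - k) → K) →ₗ[K] K :=
    { toFun := fun f => f ⬝ᵥ v w i
      map_add' := fun f g => add_dotProduct f g _
      map_smul' := fun r f => smul_dotProduct r f _ }
  -- Functionals killing the labels of the fixed ones; the free coordinates act on this space by
  -- evaluation.
  let V := commonZeros S φ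
  have hV := finrank_le_finrank_commonZeros S φ
  rw [Module.finrank_fin_fun] at hV
  have hFc : Fᶜ.card = d := by
    rw [Finset.card_compl, Fintype.card_fin]
    omega
  obtain ⟨f, hf, T, hT, hTb, hz⟩ := h b hb hbL V (Fin n) Fᶜ (fun i => (φ i).comp V.subtype)
    (by simp only [V]; omega) hFc
  have hTF (i) (hi : i ∈ T) : i ∉ F := Finset.mem_compl.1 (hT hi)
  have hdisj : Disjoint S T := Finset.disjoint_left.2 fun i hi hi' =>
    hTF i hi' (Finset.mem_filter.1 hi).1
  let x : Fin n → Bool := fun i => decide (i ∈ S ∪ T)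
  have hx (i) : x i = true ↔ i ∈ S ∪ T := by simp [x]
  have hcard : (Finset.univ.filter fun i => x i = true).card = w := by
    simp only [hx, Finset.filter_univ_mem]
    rw [Finset.card_union_of_disjoint hdisj, hTb]
  refine ⟨x, ?_, fun i hi => ?_⟩
  · have hwn : w ≤ n := by
      rw [← hcard]
      simpa using Finset.card_le_univ (Finset.univ.filter fun i => x i = true)
    rw [Finset.mem_coe, spanTransversal, Finset.mem_biUnion]
    refine ⟨w, Finset.mem_range.2 (by omega), ?_⟩
    rw [if_pos hmod, mem_nonSpanning]
    refine ⟨by simpa [cubeLayer] using hcard, f, by simpa using hf, fun i hi => ?_⟩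
    rcases Finset.mem_union.1 ((hx i).1 hi) with h | h
    · exact mem_commonZeros.1 f.2 i h
    · exact hz i h
  · have hiT : i ∉ T := fun h => hTF i h hi
    rw [Bool.eq_iff_iff, hx]
    simp [hiT, S, hi]

/-- Every residue class `c` yields a transversal, and together the `L` of them use each layer once;
averaging over `c` gives the factor `L`. -/
theorem mul_minTransversal_le (K : Type) [Field K] [Fintype K] {d k b₀ L : ℕ} (hL : 0 < L)
    (h : ∀ b, b₀ ≤ b → b < b₀ + L → ForcesCommonZeros K d (b - k) b) (n : ℕ) :
    (Fintype.card K - 1) * Fintype.card K ^ k * L * minTransversal n d ≤ 2 ^ n := by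
  choose v hv using exists_card_nonSpanning_sub_le K n k
  calc _ = (Fintype.card K - 1) * Fintype.card K ^ k *
        ∑ c ∈ Finset.range L, minTransversal n d := by
        rw [Finset.sum_const, Finset.card_range, smul_eq_mul, mul_assoc]
    _ ≤ (Fintype.card K - 1) * Fintype.card K ^ k *
        ∑ c ∈ Finset.range L, (spanTransversal v L c).card := by
        refine Nat.mul_le_mul_left _ (Finset.sum_le_sum fun c hc => minTransversal_le ?_)
        exact meetsAllSubcubes_spanTransversal (Finset.mem_range.1 hc) h v
    _ ≤ (Fintype.card K - 1) * Fintype.card K ^ k *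
        ∑ w ∈ Finset.range (n + 1), (nonSpanning (v w) w).card :=
        Nat.mul_le_mul_left _ (sum_card_spanTransversal_le hL v)
    _ ≤ ∑ w ∈ Finset.range (n + 1), (cubeLayer n w).card := by
        rw [Finset.mul_sum]
        exact Finset.sum_le_sum fun w _ => hv w
    _ = 2 ^ n := sum_card_cubeLayer n

theorem cubeGamma_le_of_forcesCommonZeros (K : Type) [Field K] [Fintype K] {d k b₀ L : ℕ}
    (hL : 0 < L)
    (h : ∀ b, b₀ ≤ b → b < b₀ + L → ForcesCommonZeros K d (b - k) b) :
    cubeGamma d ≤ 1 / ((Fintype.card K - 1) * Fintype.card K ^ k * L : ℕ) :=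
  cubeGamma_le_of_mul_le
    (Nat.mul_pos (Nat.mul_pos (Nat.sub_pos_of_lt Fintype.one_lt_card)
      (pow_pos Fintype.card_pos k)) hL)
    (mul_minTransversal_le K hL h)

/-! ### The two bounds. -/

theorem cubeGamma_lt_one_div {d : ℕ} (hd : 8 ≤ d) : cubeGamma d < 1 / ((d : ℝ) + 1) := by
  have : Fact (Nat.Prime 3) := ⟨Nat.prime_three⟩
  have h := cubeGamma_le_of_forcesCommonZeros (ZMod 3) (d := d) (k := 0) (b₀ := 2) (L := d - 3)
    (by omega) fun b hb hbL => forcesCommonZeros_zmod_three (by omega) hb (by omega)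
  refine h.trans_lt (one_div_lt_one_div_of_lt (by positivity) ?_)
  -- This is where `8 ≤ d` is sharp: `d + 1 < 2 (d - 3)` means `d > 7`.
  have : d + 1 < (3 - 1) * 3 ^ 0 * (d - 3) := by omega
  rw [ZMod.card]
  exact_mod_cast this

theorem cubeGamma_le_one_div_two_pow (k : ℕ) {d : ℕ} (hd : 3 * k + 4 ≤ d) :
    cubeGamma d ≤ 1 / 2 ^ k := by
  have h := cubeGamma_le_of_forcesCommonZeros (ZMod 2) (d := d) (k := k) (b₀ := k + 2) (L := 1)
    (by omega) fun b hb hbL => by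
      obtain rfl : b = k + 2 := by omega
      rw [Nat.add_sub_cancel_left]
      exact forcesCommonZeros_zmod_two (by omega)
  simpa using h

/-- The points of a fixed parity meet every edge of the cube. -/
theorem two_mul_minTransversal_le_two_pow {d : ℕ} (hd : 1 ≤ d) (n : ℕ) :
    2 * minTransversal n d ≤ 2 ^ n := by
  let P (p : Bool) : Finset (Fin n → Bool) :=
    Finset.univ.filter fun x => decide (Even (∑ i, (x i).toNat)) = p
  have hP (p : Bool) : MeetsAllSubcubes n d (P p) := by
    rintro _ ⟨F, y, hF, rfl⟩
    obtain ⟨i, hi⟩ : ∃ i, i ∉ F := by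
      by_contra! h
      have : F = Finset.univ := Finset.eq_univ_of_forall h
      simp [this] at hF
      omega
    have hsum (b : Bool) : ∑ j, (Function.update y i b j).toNat
        = b.toNat + ∑ j ∈ Finset.univ \ {i}, (y j).toNat := by
      rw [← Finset.sum_sdiff (Finset.subset_univ {i}), add_comm]
      simp only [Finset.sum_singleton, Function.update_self]
      congr 1
      refine Finset.sum_congr rfl fun j hj => ?_
      rw [Function.update_of_ne (by simpa using hj)]
    obtain ⟨b, hb⟩ : ∃ b : Bool, Function.update y i b ∈ P p := by
      simp only [P, Finset.mem_filter, Finset.mem_univ, true_and, hsum]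
      by_cases h : Even (∑ j ∈ Finset.univ \ {i}, (y j).toNat) <;> cases p
      · exact ⟨true, by simpa [Nat.even_add] using h⟩
      · exact ⟨false, by simpa using h⟩
      · exact ⟨false, by simpa using h⟩
      · exact ⟨true, by simpa [Nat.even_add] using h⟩
    refine ⟨_, hb, fun j hj => Function.update_of_ne ?_ _ _⟩
    rintro rfl
    exact hi hj
  have h1 := minTransversal_le (hP true)
  have h2 := minTransversal_le (hP false)
  have h3 := Finset.card_filter_add_card_filter_not (s := (Finset.univ : Finset (Fin n → Bool)))
    (fun x => decide (Even (∑ i, (x i).toNat)) = true)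
  simp only [Bool.not_eq_true, Finset.card_univ, Fintype.card_pi, Fintype.card_bool,
    Finset.prod_const, Fintype.card_fin] at h3
  simp only [P] at h1 h2
  omega

theorem exists_cubeGamma_le_pow : ∃ c : ℝ, 0 < c ∧ c < 1 ∧ ∀ d : ℕ, cubeGamma d ≤ c ^ d := by
  -- With `c = 2 ^ (-1/12)`, the parity bound `1 / 2` covers `1 ≤ d ≤ 12`, and for larger `d` the
  -- choice `k = (d - 4) / 3` satisfies `d ≤ 12 k`.
  obtain ⟨c, hc, hc12⟩ : ∃ c : ℝ, 0 < c ∧ c ^ 12 = 1 / 2 :=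
    ⟨(1 / 2 : ℝ) ^ (1 / 12 : ℝ), by positivity, by
      rw [← Real.rpow_natCast, ← Real.rpow_mul (by norm_num)]; norm_num⟩
  have hc1 : c < 1 := by
    by_contra! h
    linarith [one_le_pow₀ h (n := 12)]
  refine ⟨c, hc, hc1, fun d => ?_⟩
  obtain rfl | hd := d.eq_zero_or_pos
  · simpa using cubeGamma_le_of_mul_le (d := 0) one_pos
      (by simpa using fun n => minTransversal_le_two_pow n 0)
  suffices ∃ k, cubeGamma d ≤ 1 / 2 ^ k ∧ d ≤ 12 * k by
    obtain ⟨k, hk, hdk⟩ := this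
    calc cubeGamma d ≤ 1 / 2 ^ k := hk
      _ = c ^ (12 * k) := by rw [pow_mul, hc12, one_div_pow]
      _ ≤ c ^ d := pow_le_pow_of_le_one hc.le hc1.le hdk
  obtain h | h := le_total d 12
  · refine ⟨1, ?_, by omega⟩
    simpa using cubeGamma_le_of_mul_le two_pos (two_mul_minTransversal_le_two_pow hd)
  · exact ⟨(d - 4) / 3, cubeGamma_le_one_div_two_pow _ (by omega), by omega⟩

theorem theorem4 :
    (∀ d : ℕ, Tendsto (fun n : ℕ => (minTransversal n d : ℝ) / (2 : ℝ) ^ n) atTop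
      (𝓝 (cubeGamma d))) ∧
    (∃ c : ℝ, 0 < c ∧ c < 1 ∧ ∀ d : ℕ, cubeGamma d ≤ c ^ d) ∧
    (∀ d : ℕ, 8 ≤ d → cubeGamma d < 1 / ((d : ℝ) + 1)) :=
  ⟨tendsto_cubeGamma, exists_cubeGamma_le_pow, fun _ => cubeGamma_lt_one_div⟩
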